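/- Let $(M,\omega)$ be a compact connected Kähler manifold of complex dimension $n$, and let $(L,h,\nabla)$ be a quantum line bundle on it: $L$ is a holomorphic line bundle on $M$, $h$ is a Hermitian metric on $L$, and $\nabla$ is a connection on $L$ that is compatible with $h$ and with the complex structure of $L$ and satisfies $$\nabla_X\nabla_Y-\nabla_Y\nabla_X-\nabla_{[X,Y]}=-\mathrm{i}\,\omega(X,Y)$$ for all smooth vector fields $X,Y$. Let $m\ge 0$ be an integer, let $L^m=L^{\otimes m}$ carry the metric $h^{(m)}$ induced by $h$ (Hermitian metrics are anti-linear in the first argument), and equip the space $\Gamma_\infty(M,L^m)$ of smooth sections with the scalar product $$\langle\varphi,\psi\rangle=\int_M h^{(m)}(\varphi,\psi)\,\Omega,\qquad \Omega=\tfrac1{n!}\,\omega^{\wedge n}.$$ Let $L^2(M,L^m)$ be the completion of $\Gamma_\infty(M,L^m)$, let $\Gamma_{hol}(M,L^m)$ be its (finite-dimensional) subspace of global holomorphic sections, and let $\Pi^{(m)}:L^2(M,L^m)\to\Gamma_{hol}(M,L^m)$ be the orthogonal projection. For a smooth function $f:M\to\mathbb C$ the Toeplitz operator of level $m$ is $$T_f^{(m)}:\Gamma_{hol}(M,L^m)\to\Gamma_{hol}(M,L^m),\qquad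 T_f^{(m)}s=\Pi^{(m)}(f\cdot s).$$ Then for every selfadjoint operator $A\in\mathrm{End}(\Gamma_{hol}(M,L^m))$ there exists a real-valued smooth function $f$ on $M$ such that $A=T_f^{(m)}$. -/

import Mathlib

open Bundle Manifold MeasureTheory Set Topology
open scoped ContDiff TensorProduct ENNReal ComplexConjugate

noncomputable section

/-- The model space `ℂⁿ` of an `n`-dimensional complex manifold.  A complex manifold `M` is a
manifold with `IsManifold 𝓘(ℂ, CSpace n) ω M` (complex analytic transition maps). -/
abbrev CSpace (n : ℕ) := EuclideanSpace ℂ (Fin n)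

/-- The smooth real manifold underlying a complex manifold (same charts). -/
instance CSpace.isManifold_real {n : ℕ} {M : Type*} [TopologicalSpace M]
    [ChartedSpace (CSpace n) M] [h : IsManifold 𝓘(ℂ, CSpace n) ω M] :
    IsManifold 𝓘(ℝ, CSpace n) ∞ M := by
  apply isManifold_of_contDiffOn
  intro e e' he he'
  have h1 := (contDiffGroupoid ω 𝓘(ℂ, CSpace n)).compatible he he'
  have h2 : ContDiffOn ℂ ω (e.symm ≫ₕ e') (e.symm ≫ₕ e').source := by
    simpa [contDiffPregroupoid] using ((mem_groupoid_of_pregroupoid).1 h1).1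
  have h3 : ContDiffOn ℝ ∞ (e.symm ≫ₕ e') (e.symm ≫ₕ e').source :=
    (h2.restrict_scalars ℝ).of_le (by simp)
  simpa using h3

section Kahler

variable {n : ℕ} {M : Type*} [TopologicalSpace M] [ChartedSpace (CSpace n) M]

/-- The almost complex structure `J` of a complex manifold: multiplication by `i` on the (real)
tangent space. -/
def complexJ {x : M} (v : TangentSpace 𝓘(ℝ, CSpace n) x) : TangentSpace 𝓘(ℝ, CSpace n) x :=
  let u : CSpace n := v
  (Complex.I • u : CSpace n)

/-- The expression on `ℂⁿ` of a field of real alternating 2-forms on `M` in the chart `e`, that is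
the pull-back under `e.symm`. -/
def formInChart (w : ∀ x : M, TangentSpace 𝓘(ℝ, CSpace n) x [⋀^Fin 2]→L[ℝ] ℝ)
    (e : OpenPartialHomeomorph M (CSpace n)) (y : CSpace n) : CSpace n [⋀^Fin 2]→L[ℝ] ℝ :=
  (w (e.symm y)).compContinuousLinearMap
    (mfderiv 𝓘(ℝ, CSpace n) 𝓘(ℝ, CSpace n) e.symm y)

variable (n M) in
/-- A Kähler form: a smooth, closed, positive real (1,1)-form. -/
structure KahlerForm where
  form : ∀ x : M, TangentSpace 𝓘(ℝ, CSpace n) x [⋀^Fin 2]→L[ℝ] ℝ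
  smooth : ∀ e ∈ atlas (CSpace n) M, ContDiffOn ℝ ∞ (formInChart form e) e.target
  closed : ∀ e ∈ atlas (CSpace n) M, ∀ y ∈ e.target, extDeriv (formInChart form e) y = 0
  type_one_one : ∀ (x : M) (u v : TangentSpace 𝓘(ℝ, CSpace n) x),
    form x ![complexJ u, complexJ v] = form x ![u, v]
  pos : ∀ (x : M) (u : TangentSpace 𝓘(ℝ, CSpace n) x), u ≠ 0 → 0 < form x ![u, complexJ u]

namespace KahlerForm

variable (K : KahlerForm n M)

/-- The matrix `g i j` with `ω = i ∑ g i j dzᵢ ∧ dz̄ⱼ` in the chart `e`; explicitly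
`g i j = (ω(∂ᵢ, J ∂ⱼ) - i ω(∂ᵢ, ∂ⱼ)) / 2` with `∂ⱼ = ∂/∂xⱼ`, `zⱼ = xⱼ + i yⱼ`. -/
def gMatrix (e : OpenPartialHomeomorph M (CSpace n)) (y : CSpace n) :
    Matrix (Fin n) (Fin n) ℂ :=
  Matrix.of fun i j =>
    ((formInChart K.form e y ![EuclideanSpace.single i 1, EuclideanSpace.single j Complex.I] : ℂ)
      - Complex.I *
        formInChart K.form e y ![EuclideanSpace.single i 1, EuclideanSpace.single j 1]) / 2

/-- The density of the Liouville form `Ω = ωⁿ / n!` in the chart `e` with respect to Lebesgue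
measure on `ℂⁿ`.  As `ω = i ∑ g i j dzᵢ ∧ dz̄ⱼ` and `i dzⱼ ∧ dz̄ⱼ = 2 dxⱼ ∧ dyⱼ`, it is
`2ⁿ det g` (a positive real number, because `g` is hermitian and positive definite). -/
def liouvilleDensity (e : OpenPartialHomeomorph M (CSpace n)) (y : CSpace n) : ℝ :=
  2 ^ n * (K.gMatrix e y).det.re

lemma continuousOn_liouvilleDensity {e : OpenPartialHomeomorph M (CSpace n)}
    (he : e ∈ atlas (CSpace n) M) : ContinuousOn (K.liouvilleDensity e) e.target := by
  have hc : ∀ v : Fin 2 → CSpace n,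
      ContinuousOn (fun y => formInChart K.form e y v) e.target := fun v =>
    (ContinuousAlternatingMap.apply ℝ (CSpace n) ℝ v).continuous.comp_continuousOn
      (K.smooth e he).continuousOn
  have hg : ContinuousOn (K.gMatrix e) e.target := by
    refine continuousOn_pi.2 fun i => continuousOn_pi.2 fun j => ?_
    simp only [gMatrix, Matrix.of_apply]
    have h1 := Complex.continuous_ofReal.comp_continuousOn
      (hc ![EuclideanSpace.single i 1, EuclideanSpace.single j Complex.I])
    have h2 := Complex.continuous_ofReal.comp_continuousOn
      (hc ![EuclideanSpace.single i 1, EuclideanSpace.single j 1])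
    exact (h1.sub (continuousOn_const.mul h2)).div_const 2
  have hd : ContinuousOn (fun y => (K.gMatrix e y).det) e.target :=
    (Continuous.matrix_det continuous_id).comp_continuousOn hg
  exact continuousOn_const.mul (Complex.continuous_re.comp_continuousOn hd)

end KahlerForm

section Liouville

variable [IsManifold 𝓘(ℂ, CSpace n) ω M] [T2Space M] [CompactSpace M]

variable (n M) in
/-- A smooth partition of unity subordinate to the covering by the preferred charts. -/
def chartPartition : SmoothPartitionOfUnity M 𝓘(ℝ, CSpace n) M univ :=
  (SmoothPartitionOfUnity.exists_isSubordinate_chartAt_source 𝓘(ℝ, CSpace n) M).choose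

variable (n M) in
lemma chartPartition_isSubordinate :
    (chartPartition n M).IsSubordinate fun x => (chartAt (CSpace n) x).source :=
  (SmoothPartitionOfUnity.exists_isSubordinate_chartAt_source 𝓘(ℝ, CSpace n) M).choose_spec

/-- The part `ρ_p Ω` of the Liouville measure, on the chart at `p`, as a measure on `ℂⁿ`. -/
def KahlerForm.liouvillePiece (K : KahlerForm n M) (p : M) : Measure (CSpace n) :=
  (volume.restrict (chartAt (CSpace n) p).target).withDensity fun y =>
    ENNReal.ofReal (chartPartition n M p ((chartAt (CSpace n) p).symm y) *
      K.liouvilleDensity (chartAt (CSpace n) p) y)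

variable [MeasurableSpace M]

/-- The measure on `M` given by the Liouville volume form `Ω = ωⁿ / n!`: as usual, the integral of
a top degree form is computed in charts by means of a partition of unity (and does not depend on
the choice of it). -/
def KahlerForm.liouville (K : KahlerForm n M) : Measure M :=
  Measure.sum fun p : M => (K.liouvillePiece p).map (chartAt (CSpace n) p).symm

lemma KahlerForm.isFiniteMeasure_liouvillePiece (K : KahlerForm n M) (p : M) :
    IsFiniteMeasure (K.liouvillePiece p) := by
  set e := chartAt (CSpace n) p with he
  have hsub : tsupport (chartPartition n M p) ⊆ e.source := chartPartition_isSubordinate n M p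
  have hK : IsCompact (e '' tsupport (chartPartition n M p)) :=
    ((isClosed_tsupport _).isCompact).image_of_continuousOn (e.continuousOn.mono hsub)
  have hKt : e '' tsupport (chartPartition n M p) ⊆ e.target := by
    rintro _ ⟨x, hx, rfl⟩; exact e.map_source (hsub hx)
  have hc : ContinuousOn (fun y => chartPartition n M p (e.symm y) * K.liouvilleDensity e y)
      e.target :=
    ((chartPartition n M p).contMDiff.continuous.comp_continuousOn e.continuousOn_symm).mul
      (K.continuousOn_liouvilleDensity (chart_mem_atlas _ _))
  constructor
  rw [KahlerForm.liouvillePiece, withDensity_apply _ MeasurableSet.univ, Measure.restrict_univ]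
  have hint : IntegrableOn (fun y => chartPartition n M p (e.symm y) * K.liouvilleDensity e y)
      (e '' tsupport (chartPartition n M p)) volume :=
    (hc.mono hKt).integrableOn_compact hK
  have hint2 : IntegrableOn (fun y => chartPartition n M p (e.symm y) * K.liouvilleDensity e y)
      e.target volume := by
    refine hint.of_forall_sdiff_eq_zero e.open_target.measurableSet fun y hy => ?_
    have : chartPartition n M p (e.symm y) = 0 := by
      by_contra h
      exact hy.2 ⟨e.symm y, subset_tsupport _ h, e.right_inv hy.1⟩
    simp [this]
  exact hint2.lintegral_lt_top

instance KahlerForm.isFiniteMeasure_liouville [BorelSpace M] (K : KahlerForm n M) :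
    IsFiniteMeasure K.liouville := by
  have hfin : {p : M | (Function.support (chartPartition n M p)).Nonempty}.Finite :=
    (chartPartition n M).locallyFinite.finite_nonempty_of_compact
  constructor
  rw [KahlerForm.liouville, Measure.sum_apply _ MeasurableSet.univ, tsum_eq_sum (s := hfin.toFinset)]
  · refine ENNReal.sum_lt_top.2 fun p _ => ?_
    have := K.isFiniteMeasure_liouvillePiece p
    exact measure_lt_top _ _
  · intro p hp
    have h0 : ∀ x, chartPartition n M p x = 0 := by
      intro x
      by_contra h
      exact hp (hfin.mem_toFinset.2 ⟨x, h⟩)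
    have : K.liouvillePiece p = 0 := by
      simp [KahlerForm.liouvillePiece, h0]
    simp [this]

end Liouville

end Kahler

section LineBundle

variable {n : ℕ} {M : Type*} [TopologicalSpace M] [ChartedSpace (CSpace n) M]
  (L : M → Type*) [∀ x, AddCommGroup (L x)] [∀ x, Module ℂ (L x)] [∀ x, TopologicalSpace (L x)]
  [TopologicalSpace (TotalSpace ℂ L)] [FiberBundle ℂ L] [VectorBundle ℂ ℂ L]

variable (n) in
/-- A smooth Hermitian metric on a complex line bundle, anti-linear in the first argument. -/
structure HermitianMetric where
  inner : ∀ x, L x →ₗ⋆[ℂ] L x →ₗ[ℂ] ℂ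
  conj_symm : ∀ x (u v : L x), conj (inner x u v) = inner x v u
  pos : ∀ x (u : L x), u ≠ 0 → 0 < (inner x u u).re
  /-- In the local frame `e.symm x 1` the metric is a smooth function. -/
  smooth : ∀ (e : Trivialization ℂ (π ℂ L)) [MemTrivializationAtlas e],
    ContMDiffOn 𝓘(ℝ, CSpace n) 𝓘(ℝ, ℝ) ∞
      (fun x => (inner x (e.symm x 1) (e.symm x 1)).re) e.baseSet

variable {L}

variable (n) in
/-- `C^∞` sections of `L`. -/
def IsSmoothSection (s : ∀ x, L x) : Prop :=
  ContMDiff 𝓘(ℝ, CSpace n) (𝓘(ℝ, CSpace n).prod 𝓘(ℝ, ℂ)) ∞ fun x => TotalSpace.mk' ℂ x (s x)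

variable (n) in
/-- Sections of `L` that are holomorphic on the set `U`. -/
def IsHolomorphicSectionOn (s : ∀ x, L x) (U : Set M) : Prop :=
  ContMDiffOn 𝓘(ℂ, CSpace n) (𝓘(ℂ, CSpace n).prod 𝓘(ℂ, ℂ)) ω (fun x => TotalSpace.mk' ℂ x (s x)) U

variable [IsManifold 𝓘(ℂ, CSpace n) ω M]

/-- `C^∞` real vector fields on `M`. -/
def IsSmoothVectorField (X : ∀ x : M, TangentSpace 𝓘(ℝ, CSpace n) x) : Prop :=
  ContMDiff 𝓘(ℝ, CSpace n) 𝓘(ℝ, CSpace n).tangent ∞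
    fun x => (⟨x, X x⟩ : TangentBundle 𝓘(ℝ, CSpace n) M)

/-- The derivative `X f` of a complex-valued function along a vector field. -/
def lieDerivFun (X : ∀ x : M, TangentSpace 𝓘(ℝ, CSpace n) x) (f : M → ℂ) (x : M) : ℂ :=
  mfderiv 𝓘(ℝ, CSpace n) 𝓘(ℝ, ℂ) f x (X x)

variable (L) in
/-- A quantum line bundle structure `(h, ∇)` on the holomorphic line bundle `L` over the Kähler
manifold `(M, ω)`: a Hermitian metric `h` and a connection `∇`, compatible with the metric and with
the complex structure, of curvature `-i ω`.  The connection is a map on smooth vector fields and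
smooth sections (its values on other arguments are irrelevant). -/
structure QuantumLineBundle (K : KahlerForm n M) where
  metric : HermitianMetric n L
  nabla : (∀ x : M, TangentSpace 𝓘(ℝ, CSpace n) x) → (∀ x, L x) → ∀ x, L x
  nabla_smooth : ∀ X s, IsSmoothVectorField X → IsSmoothSection n s →
    IsSmoothSection n (nabla X s)
  nabla_add_left : ∀ X Y s, IsSmoothVectorField X → IsSmoothVectorField Y →
    IsSmoothSection n s → nabla (X + Y) s = nabla X s + nabla Y s
  nabla_smul_left : ∀ (f : M → ℝ) X s, ContMDiff 𝓘(ℝ, CSpace n) 𝓘(ℝ, ℝ) ∞ f →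
    IsSmoothVectorField X → IsSmoothSection n s →
    nabla (fun x => f x • X x) s = fun x => (f x : ℂ) • nabla X s x
  nabla_add_right : ∀ X s t, IsSmoothVectorField X → IsSmoothSection n s →
    IsSmoothSection n t → nabla X (s + t) = nabla X s + nabla X t
  leibniz : ∀ (f : M → ℂ) X s, ContMDiff 𝓘(ℝ, CSpace n) 𝓘(ℝ, ℂ) ∞ f →
    IsSmoothVectorField X → IsSmoothSection n s →
    nabla X (fun x => f x • s x) = fun x => lieDerivFun X f x • s x + f x • nabla X s x
  /-- compatibility with the metric: `X h(s,t) = h(∇_X s, t) + h(s, ∇_X t)` -/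
  metric_compatible : ∀ X s t, IsSmoothVectorField X → IsSmoothSection n s →
    IsSmoothSection n t → ∀ x,
    lieDerivFun X (fun y => metric.inner y (s y) (t y)) x =
      metric.inner x (nabla X s x) (t x) + metric.inner x (s x) (nabla X t x)
  /-- compatibility with the complex structure: `∇^{0,1} s = 0` wherever `s` is holomorphic -/
  complex_compatible : ∀ X s (U : Set M), IsSmoothVectorField X → IsSmoothSection n s →
    IsOpen U → IsHolomorphicSectionOn n s U → ∀ x ∈ U,
    nabla (fun y => complexJ (X y)) s x = Complex.I • nabla X s x
  /-- the quantum condition `∇_X ∇_Y - ∇_Y ∇_X - ∇_[X,Y] = -i ω(X,Y)` -/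
  curvature : ∀ X Y s, IsSmoothVectorField X → IsSmoothVectorField Y → IsSmoothSection n s →
    ∀ x, nabla X (nabla Y s) x - nabla Y (nabla X s) x
        - nabla (VectorField.mlieBracket 𝓘(ℝ, CSpace n) X Y) s x =
      (-Complex.I * (K.form x ![X x, Y x] : ℂ)) • s x

end LineBundle

section TensorPower

variable {n : ℕ} {M : Type*} [TopologicalSpace M] [ChartedSpace (CSpace n) M]
  {L : M → Type*} [∀ x, AddCommGroup (L x)] [∀ x, Module ℂ (L x)] [∀ x, TopologicalSpace (L x)]
  [TopologicalSpace (TotalSpace ℂ L)] [FiberBundle ℂ L] [VectorBundle ℂ ℂ L]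

/-- The fibre at `x` of the tensor power `L^m`. -/
abbrev TensorFiber {M : Type*} (L : M → Type*) [∀ x, AddCommGroup (L x)] [∀ x, Module ℂ (L x)]
    (m : ℕ) (x : M) := ⨂[ℂ] _ : Fin m, L x

/-- The coordinate of an element of the fibre of `L^m` with respect to the frame `e^{⊗ m}`
associated with a local trivialization (frame) `e` of `L`. -/
def tensorCoord (e : Trivialization ℂ (π ℂ L)) [MemTrivializationAtlas e] (m : ℕ) (x : M) :
    TensorFiber L m x →ₗ[ℂ] ℂ :=
  (PiTensorProduct.constantBaseRingEquiv (Fin m) ℂ).toLinearMap ∘ₗ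
    PiTensorProduct.map fun _ => e.linearMapAt ℂ x

/-- The squared length `ĥ` of the local frame of `L` given by the trivialization `e`. -/
def HermitianMetric.local (h : HermitianMetric n L) (e : Trivialization ℂ (π ℂ L)) (x : M) : ℝ :=
  (h.inner x (e.symm x 1) (e.symm x 1)).re

/-- The metric `h^(m)` on `L^m`: in the frame `e^{⊗ m}` it is represented by `ĥ^m`, if `ĥ`
represents `h` in the frame `e` of `L`.  Here the preferred frame at `x` is used; by
`tensorMetric_eq` and `tensorMetric_tprod` the choice does not matter. -/
def HermitianMetric.tensorMetric (h : HermitianMetric n L) (m : ℕ) (x : M)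
    (s t : TensorFiber L m x) : ℂ :=
  conj (tensorCoord (trivializationAt ℂ L x) m x s) * tensorCoord (trivializationAt ℂ L x) m x t *
    (h.local (trivializationAt ℂ L x) x : ℂ) ^ m

lemma tensorCoord_tprod (e : Trivialization ℂ (π ℂ L)) [MemTrivializationAtlas e] (m : ℕ) (x : M)
    (v : Fin m → L x) :
    tensorCoord e m x (PiTensorProduct.tprod ℂ v) = ∏ i, e.linearMapAt ℂ x (v i) := by
  simp [tensorCoord]

lemma eq_linearMapAt_smul (e : Trivialization ℂ (π ℂ L)) [MemTrivializationAtlas e] {x : M}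
    (hx : x ∈ e.baseSet) (v : L x) : v = e.linearMapAt ℂ x v • e.symm x 1 := by
  have h1 := e.symmₗ_linearMapAt (R := ℂ) hx v
  have h2 : e.symmₗ ℂ x (e.linearMapAt ℂ x v) = e.linearMapAt ℂ x v • e.symmₗ ℂ x 1 := by
    rw [← map_smul, smul_eq_mul, mul_one]
  rw [h2, e.coe_symmₗ hx] at h1
  exact h1.symm

lemma HermitianMetric.inner_eq (h : HermitianMetric n L) (e : Trivialization ℂ (π ℂ L))
    [MemTrivializationAtlas e] {x : M} (hx : x ∈ e.baseSet) (u v : L x) :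
    h.inner x u v = conj (e.linearMapAt ℂ x u) * e.linearMapAt ℂ x v * (h.local e x : ℂ) := by
  have h1 : (h.local e x : ℂ) = h.inner x (e.symm x 1) (e.symm x 1) :=
    Complex.conj_eq_iff_re.1 (h.conj_symm x _ _)
  conv_lhs => rw [eq_linearMapAt_smul e hx u, eq_linearMapAt_smul e hx v]
  rw [h1]
  simp
  ring

lemma tensorCoord_change (e e' : Trivialization ℂ (π ℂ L)) [MemTrivializationAtlas e]
    [MemTrivializationAtlas e'] (m : ℕ) {x : M} (hx : x ∈ e.baseSet) (s : TensorFiber L m x) :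
    tensorCoord e' m x s = (e'.linearMapAt ℂ x (e.symm x 1)) ^ m * tensorCoord e m x s := by
  have : tensorCoord e' m x =
      (e'.linearMapAt ℂ x (e.symm x 1)) ^ m • tensorCoord e m x := by
    refine PiTensorProduct.ext (MultilinearMap.ext fun v => ?_)
    have hv : ∀ i, e'.linearMapAt ℂ x (v i) =
        e'.linearMapAt ℂ x (e.symm x 1) * e.linearMapAt ℂ x (v i) := fun i => by
      conv_lhs => rw [eq_linearMapAt_smul e hx (v i)]
      rw [map_smul, smul_eq_mul, mul_comm]
    simp only [LinearMap.compMultilinearMap_apply, LinearMap.smul_apply, tensorCoord_tprod, hv,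
      Finset.prod_mul_distrib, Finset.prod_const, Finset.card_univ, Fintype.card_fin, smul_eq_mul]
  rw [this]; rfl

/-- The formula for `h^(m)` holds in every local frame. -/
lemma HermitianMetric.tensorMetric_eq (h : HermitianMetric n L) (e : Trivialization ℂ (π ℂ L))
    [MemTrivializationAtlas e] (m : ℕ) {x : M} (hx : x ∈ e.baseSet) (s t : TensorFiber L m x) :
    h.tensorMetric m x s t =
      conj (tensorCoord e m x s) * tensorCoord e m x t * (h.local e x : ℂ) ^ m := by
  have hx' : x ∈ (trivializationAt ℂ L x).baseSet := mem_baseSet_trivializationAt ℂ L x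
  have h1 := h.inner_eq (trivializationAt ℂ L x) hx' (e.symm x 1) (e.symm x 1)
  have h2 : (h.local e x : ℂ) = h.inner x (e.symm x 1) (e.symm x 1) :=
    Complex.conj_eq_iff_re.1 (h.conj_symm x _ _)
  rw [HermitianMetric.tensorMetric, tensorCoord_change e (trivializationAt ℂ L x) m hx s,
    tensorCoord_change e (trivializationAt ℂ L x) m hx t, h2, h1, map_mul, map_pow]
  ring

/-- `h^(m)(u₁ ⊗ ⋯ ⊗ u_m, v₁ ⊗ ⋯ ⊗ v_m) = h(u₁, v₁) ⋯ h(u_m, v_m)`. -/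
lemma HermitianMetric.tensorMetric_tprod (h : HermitianMetric n L) (m : ℕ) (x : M)
    (u v : Fin m → L x) :
    h.tensorMetric m x (PiTensorProduct.tprod ℂ u) (PiTensorProduct.tprod ℂ v) =
      ∏ i, h.inner x (u i) (v i) := by
  have hx' : x ∈ (trivializationAt ℂ L x).baseSet := mem_baseSet_trivializationAt ℂ L x
  simp only [HermitianMetric.tensorMetric, tensorCoord_tprod, h.inner_eq _ hx',
    Finset.prod_mul_distrib, Finset.prod_const, Finset.card_univ, Fintype.card_fin, map_prod]

lemma HermitianMetric.local_nonneg (h : HermitianMetric n L) (e : Trivialization ℂ (π ℂ L))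
    (x : M) : 0 ≤ h.local e x := by
  by_cases h0 : e.symm x 1 = 0
  · simp [HermitianMetric.local, h0]
  · exact (h.pos x _ h0).le

variable (n) in
/-- `C^∞` sections of `L^m`: the coordinates in all local frames are smooth. -/
def IsSmoothTensorSection (m : ℕ) (s : ∀ x, TensorFiber L m x) : Prop :=
  ∀ (e : Trivialization ℂ (π ℂ L)) [MemTrivializationAtlas e],
    ContMDiffOn 𝓘(ℝ, CSpace n) 𝓘(ℝ, ℂ) ∞ (fun x => tensorCoord e m x (s x)) e.baseSet

variable (n) in
/-- Holomorphic sections of `L^m`: the coordinates in all local holomorphic frames are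
holomorphic. -/
def IsHolomorphicTensorSection (m : ℕ) (s : ∀ x, TensorFiber L m x) : Prop :=
  ∀ (e : Trivialization ℂ (π ℂ L)) [MemTrivializationAtlas e],
    ContMDiffOn 𝓘(ℂ, CSpace n) 𝓘(ℂ, ℂ) ω (fun x => tensorCoord e m x (s x)) e.baseSet

lemma HermitianMetric.continuous_tensorMetric (h : HermitianMetric n L) {m : ℕ}
    {s t : ∀ x, TensorFiber L m x} (hs : IsSmoothTensorSection n m s)
    (ht : IsSmoothTensorSection n m t) :
    Continuous fun x => h.tensorMetric m x (s x) (t x) := by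
  rw [continuous_iff_continuousAt]
  intro x
  set e := trivializationAt ℂ L x
  have hmem : e.baseSet ∈ 𝓝 x := e.open_baseSet.mem_nhds (mem_baseSet_trivializationAt ℂ L x)
  have h1 : ContinuousOn (fun y => conj (tensorCoord e m y (s y)) * tensorCoord e m y (t y) *
      (h.local e y : ℂ) ^ m) e.baseSet :=
    ((Complex.continuous_conj.comp_continuousOn (hs e).continuousOn).mul
      (ht e).continuousOn).mul
      ((Complex.continuous_ofReal.comp_continuousOn (h.smooth e).continuousOn).pow m)
  refine (h1.continuousAt hmem).congr ?_
  filter_upwards [hmem] with y hy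
  exact (h.tensorMetric_eq e m hy _ _).symm

variable (n L) in
/-- The space of `C^∞` sections of `L^m`, as a subspace of the space of all sections. -/
def smoothSubmodule (m : ℕ) : Submodule ℂ (∀ x, TensorFiber L m x) where
  carrier := {s | IsSmoothTensorSection n m s}
  zero_mem' := fun e _ => by simpa using contMDiffOn_const
  add_mem' := fun {s t} hs ht e _ => by
    simpa [Pi.add_def] using (hs e).add (ht e)
  smul_mem' := fun c s hs e _ => by
    have : ContMDiff 𝓘(ℝ, ℂ) 𝓘(ℝ, ℂ) ∞ fun z : ℂ => c * z :=
      (contDiff_const.mul contDiff_id).contMDiff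
    simpa [Function.comp_def] using this.comp_contMDiffOn (hs e)

end TensorPower

section Toeplitz

variable {n : ℕ} {M : Type*} [TopologicalSpace M] [ChartedSpace (CSpace n) M]
  [IsManifold 𝓘(ℂ, CSpace n) ω M]
  {L : M → Type*} [∀ x, AddCommGroup (L x)] [∀ x, Module ℂ (L x)] [∀ x, TopologicalSpace (L x)]
  [TopologicalSpace (TotalSpace ℂ L)] [FiberBundle ℂ L] [VectorBundle ℂ ℂ L]
  {K : KahlerForm n M}

/-- `Γ_∞(M, L^m)`, the space of `C^∞` sections of the `m`-th power of the quantum line bundle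
`Q = (L, h, ∇)`, with the `L²` scalar product defined below. -/
def SmoothSections (_Q : QuantumLineBundle L K) (m : ℕ) : Type _ := smoothSubmodule n L m

namespace SmoothSections

variable {Q : QuantumLineBundle L K} {m : ℕ}

instance : AddCommGroup (SmoothSections Q m) :=
  inferInstanceAs (AddCommGroup (smoothSubmodule n L m))

instance : Module ℂ (SmoothSections Q m) :=
  inferInstanceAs (Module ℂ (smoothSubmodule n L m))

/-- The value of a section. -/
def val (s : SmoothSections Q m) (x : M) : TensorFiber L m x := s.1 x

lemma smooth (s : SmoothSections Q m) : IsSmoothTensorSection n m s.val := s.2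

lemma val_add (s t : SmoothSections Q m) (x : M) : (s + t).val x = s.val x + t.val x := rfl

lemma val_smul (c : ℂ) (s : SmoothSections Q m) (x : M) : (c • s).val x = c • s.val x := rfl

/-- Multiplication of a section by a complex-valued `C^∞` function. -/
def mul (f : C^∞⟮𝓘(ℝ, CSpace n), M; 𝓘(ℝ, ℂ), ℂ⟯) (s : SmoothSections Q m) : SmoothSections Q m :=
  ⟨fun x => f x • s.val x, fun e _ => by
    have : ContMDiff (𝓘(ℝ, ℂ).prod 𝓘(ℝ, ℂ)) 𝓘(ℝ, ℂ) ∞ fun z : ℂ × ℂ => z.1 * z.2 := by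
      rw [← modelWithCornersSelf_prod, chartedSpaceSelf_prod]
      exact (contDiff_fst.mul contDiff_snd).contMDiff
    simpa [Function.comp_def] using
      this.comp_contMDiffOn (f.contMDiff.contMDiffOn.prodMk (s.smooth e))⟩

variable [T2Space M] [CompactSpace M] [MeasurableSpace M] [BorelSpace M]

lemma integrable (s t : SmoothSections Q m) :
    Integrable (fun x => Q.metric.tensorMetric m x (s.val x) (t.val x)) K.liouville :=
  (Q.metric.continuous_tensorMetric s.smooth t.smooth).integrable_of_hasCompactSupport
    (HasCompactSupport.of_compactSpace _)

/-- The scalar product `⟨φ, ψ⟩ = ∫ h^(m)(φ, ψ) Ω` on `Γ_∞(M, L^m)`. -/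
instance core : PreInnerProductSpace.Core ℂ (SmoothSections Q m) where
  inner s t := ∫ x, Q.metric.tensorMetric m x (s.val x) (t.val x) ∂K.liouville
  conj_inner_symm s t := by
    rw [← integral_conj]
    refine integral_congr_ae (Filter.Eventually.of_forall fun x => ?_)
    simp only [HermitianMetric.tensorMetric, map_mul, map_pow, Complex.conj_conj,
      Complex.conj_ofReal]
    ring
  re_inner_nonneg s := by
    have h1 : ∀ x, Q.metric.tensorMetric m x (s.val x) (s.val x) =
        ((Complex.normSq (tensorCoord (trivializationAt ℂ L x) m x (s.val x)) *
          Q.metric.local (trivializationAt ℂ L x) x ^ m : ℝ) : ℂ) := fun x => by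
      simp only [HermitianMetric.tensorMetric, ← Complex.normSq_eq_conj_mul_self]
      push_cast
      rfl
    simp only [h1]
    rw [integral_complex_ofReal]
    exact integral_nonneg fun x =>
      mul_nonneg (Complex.normSq_nonneg _) (pow_nonneg (Q.metric.local_nonneg _ _) _)
  add_left s t u := by
    rw [← integral_add (integrable _ _) (integrable _ _)]
    refine integral_congr_ae (Filter.Eventually.of_forall fun x => ?_)
    simp only [HermitianMetric.tensorMetric, val_add, map_add]
    ring
  smul_left s t c := by
    rw [← integral_const_mul]
    refine integral_congr_ae (Filter.Eventually.of_forall fun x => ?_)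
    simp only [HermitianMetric.tensorMetric, val_smul, map_smul, smul_eq_mul, map_mul]
    ring

instance : SeminormedAddCommGroup (SmoothSections Q m) :=
  InnerProductSpace.Core.toSeminormedAddCommGroup (𝕜 := ℂ)

instance : InnerProductSpace ℂ (SmoothSections Q m) := InnerProductSpace.ofCore core

end SmoothSections

variable (Q : QuantumLineBundle L K) (m : ℕ)

/-- `Γ_hol(M, L^m)`, the subspace of holomorphic sections. -/
def holomorphicSections : Submodule ℂ (SmoothSections Q m) where
  carrier := {s | IsHolomorphicTensorSection n m s.val}
  zero_mem' := fun e _ => by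
    have : ∀ x, (0 : SmoothSections Q m).val x = 0 := fun x => rfl
    simpa [this] using contMDiffOn_const
  add_mem' := fun {s t} hs ht e _ => by
    simpa [SmoothSections.val_add, Pi.add_def] using (hs e).add (ht e)
  smul_mem' := fun c s hs e _ => by
    have : ContMDiff 𝓘(ℂ, ℂ) 𝓘(ℂ, ℂ) ω fun z : ℂ => c * z :=
      (contDiff_const.mul contDiff_id).contMDiff
    simpa [Function.comp_def, SmoothSections.val_smul] using this.comp_contMDiffOn (hs e)

variable [T2Space M] [CompactSpace M] [MeasurableSpace M] [BorelSpace M]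

/-- `L²(M, L^m)`, the completion of `Γ_∞(M, L^m)`. -/
abbrev L2Sections := UniformSpace.Completion (SmoothSections Q m)

/-- `Γ_hol(M, L^m)` as a subspace of `L²(M, L^m)`. -/
def holomorphicL2 : Submodule ℂ (L2Sections Q m) :=
  (holomorphicSections Q m).map (UniformSpace.Completion.toComplₗᵢ (𝕜 := ℂ)).toLinearMap

/-- The orthogonal projection `Π^(m)` of `L²(M, L^m)` onto `Γ_hol(M, L^m)`.  (This subspace is
finite-dimensional, hence closed, so that taking its closure does not change it.) -/
def holomorphicProjection : L2Sections Q m →L[ℂ] L2Sections Q m :=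
  (holomorphicL2 Q m).topologicalClosure.starProjection

variable {Q m}

/-- `A` is the Toeplitz operator `T_f^(m)`, that is `A s = Π^(m) (f s)` for all holomorphic
sections `s` of `L^m`. -/
def IsToeplitzOperator (A : Module.End ℂ (holomorphicSections Q m))
    (f : C^∞⟮𝓘(ℝ, CSpace n), M; 𝓘(ℝ, ℂ), ℂ⟯) : Prop :=
  ∀ s : holomorphicSections Q m, (((A s : SmoothSections Q m)) : L2Sections Q m) =
    holomorphicProjection Q m ((SmoothSections.mul f (s : SmoothSections Q m) :) : L2Sections Q m)

end Toeplitz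

end

/-! Let `b` be a basis of the holomorphic sections. The equation A = T_f says exactly that ∫ f h(bᵢ,
bⱼ) Ω = ⟨bᵢ, A bⱼ⟩ for all i, j, where h now denotes the metric of L^m. These are finitely many
linear conditions on f, and they can be solved within the span of the functions h(bᵢ, bⱼ)
themselves.

For a matrix C put σ_C = ∑ Cᵢⱼ h(bᵢ, bⱼ) and pair matrices by (C, D) ↦ ∫ σ_C σ_D Ω
(`symbolPairing`). The conjugate of σ_C is the symbol of the conjugate transpose, so a matrix C in
the kernel satisfies ∫ |σ_C|² Ω = 0. Since Ω charges every nonempty open set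
(`isOpenPosMeasure_liouville`), the continuous function σ_C vanishes identically. Then C = 0,
because the functions h(bᵢ, bⱼ) are linearly independent (`eq_zero_of_sum_tensorMetric_eq_zero`): in
a holomorphic frame σ_C is a positive factor times ∑ Cᵢⱼ conj(φᵢ) φⱼ, polarization frees the two
arguments from each other, and the identity theorem turns independence of the sections into
independence of the φᵢ on a ball.

An injective map from a finite-dimensional space to its dual is surjective, so every matrix (aᵢⱼ) is
attained by some F = σ_C. If the matrix is Hermitian, the conjugate of F attains it too, and so does
the real function Re F. That a finite basis exists rests on a Schwarz lemma argument
(`finiteDimensional_holomorphicSections`). -/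

noncomputable section

/-! ### Positivity of the Liouville measure. -/

section LiouvillePositivity

variable {n : ℕ} {M : Type*} [TopologicalSpace M] [ChartedSpace (CSpace n) M]

/-- The real derivative of a complex differentiable map between complex manifolds is its complex
derivative, hence complex linear. -/
lemma mfderiv_real_apply_I_smul {f : CSpace n → M} {y : CSpace n}
    (hf : MDifferentiableAt 𝓘(ℂ, CSpace n) 𝓘(ℂ, CSpace n) f y) (v : CSpace n) :
    mfderiv 𝓘(ℝ, CSpace n) 𝓘(ℝ, CSpace n) f y (Complex.I • v : CSpace n) =
      complexJ (mfderiv 𝓘(ℝ, CSpace n) 𝓘(ℝ, CSpace n) f y v) := by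
  have hd : DifferentiableAt ℂ (fun z => chartAt (CSpace n) (f y) (f z)) y := by
    have h := ((mdifferentiableAt_iff _ _).1 hf).2
    rw [show range 𝓘(ℂ, CSpace n) = univ from range_id] at h
    exact differentiableWithinAt_univ.1 h
  have hfR : MDifferentiableAt 𝓘(ℝ, CSpace n) 𝓘(ℝ, CSpace n) f y := by
    refine (mdifferentiableAt_iff _ _).2 ⟨hf.continuousAt, ?_⟩
    exact (hd.restrictScalars ℝ).differentiableWithinAt
  have h : ∀ v : CSpace n, mfderiv 𝓘(ℝ, CSpace n) 𝓘(ℝ, CSpace n) f y v =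
      (fderiv ℂ (fun z => chartAt (CSpace n) (f y) (f z)) y v : CSpace n) := fun v => by
    rw [hfR.mfderiv]
    change fderivWithin ℝ (fun z => chartAt (CSpace n) (f y) (f z)) (range id) y v = _
    rw [range_id, fderivWithin_univ, hd.fderiv_restrictScalars ℝ]
    rfl
  rw [h, h, map_smul]
  rfl

variable [IsManifold 𝓘(ℂ, CSpace n) ω M]

lemma mdifferentiableAt_atlas_symm_complex {e : OpenPartialHomeomorph M (CSpace n)}
    (he : e ∈ atlas (CSpace n) M) {y : CSpace n} (hy : y ∈ e.target) :
    MDifferentiableAt 𝓘(ℂ, CSpace n) 𝓘(ℂ, CSpace n) e.symm y := by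
  have : IsManifold 𝓘(ℂ, CSpace n) 1 M := .of_le (n := ω) (by simp)
  exact mdifferentiableAt_atlas_symm he hy

lemma mfderiv_atlas_symm_injective {e : OpenPartialHomeomorph M (CSpace n)}
    (he : e ∈ atlas (CSpace n) M) {y : CSpace n} (hy : y ∈ e.target) :
    Function.Injective (mfderiv 𝓘(ℝ, CSpace n) 𝓘(ℝ, CSpace n) e.symm y) := by
  have : IsManifold 𝓘(ℝ, CSpace n) 1 M := .of_le (n := ∞) (by simp)
  exact (mdifferentiable_of_mem_atlas (I := 𝓘(ℝ, CSpace n)) he).symm.mfderiv_injective hy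

namespace KahlerForm

variable (K : KahlerForm n M)

omit [IsManifold 𝓘(ℂ, CSpace n) ω M] in
lemma formInChart_apply (e : OpenPartialHomeomorph M (CSpace n)) (y u v : CSpace n) :
    formInChart K.form e y ![u, v] = K.form (e.symm y)
      ![mfderiv 𝓘(ℝ, CSpace n) 𝓘(ℝ, CSpace n) e.symm y u,
        mfderiv 𝓘(ℝ, CSpace n) 𝓘(ℝ, CSpace n) e.symm y v] := by
  refine congrArg (K.form (e.symm y)) (funext fun i => ?_)
  fin_cases i <;> rfl

end KahlerForm

variable (n) in
/-- An alternating form on `ℂⁿ` of type (1,1) which is positive on complex lines. -/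
structure IsPositiveOneOne (w : CSpace n [⋀^Fin 2]→L[ℝ] ℝ) : Prop where
  type_one_one : ∀ u v : CSpace n, w ![Complex.I • u, Complex.I • v] = w ![u, v]
  pos : ∀ u : CSpace n, u ≠ 0 → 0 < w ![u, Complex.I • u]

/-- The inverse chart is holomorphic, so its derivative intertwines i with J and carries the (1,1)
type over; the derivative is also injective, so positivity survives the pull-back. -/
lemma KahlerForm.isPositiveOneOne_formInChart (K : KahlerForm n M)
    {e : OpenPartialHomeomorph M (CSpace n)} (he : e ∈ atlas (CSpace n) M) {y : CSpace n}
    (hy : y ∈ e.target) : IsPositiveOneOne n (formInChart K.form e y) := by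
  have hI := mfderiv_real_apply_I_smul (mdifferentiableAt_atlas_symm_complex he hy)
  constructor
  · intro u v
    rw [K.formInChart_apply, K.formInChart_apply, hI, hI, K.type_one_one]
  · intro u hu
    rw [K.formInChart_apply, hI]
    refine K.pos _ _ fun h => hu ?_
    exact mfderiv_atlas_symm_injective he hy (h.trans (map_zero _).symm)

namespace IsPositiveOneOne

variable {w : CSpace n [⋀^Fin 2]→L[ℝ] ℝ}

lemma add_left (w : CSpace n [⋀^Fin 2]→L[ℝ] ℝ) (u u' v : CSpace n) :
    w ![u + u', v] = w ![u, v] + w ![u', v] := by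
  have h := w.map_update_add ![0, v] 0 u u'
  have h1 : ∀ z : CSpace n, Function.update ![0, v] 0 z = ![z, v] := fun z => by
    ext i; fin_cases i <;> rfl
  simpa only [h1] using h

lemma add_right (w : CSpace n [⋀^Fin 2]→L[ℝ] ℝ) (u v v' : CSpace n) :
    w ![u, v + v'] = w ![u, v] + w ![u, v'] := by
  have h := w.map_update_add ![u, 0] 1 v v'
  have h1 : ∀ z : CSpace n, Function.update ![u, 0] 1 z = ![u, z] := fun z => by
    ext i; fin_cases i <;> rfl
  simpa only [h1] using h

lemma smul_left (w : CSpace n [⋀^Fin 2]→L[ℝ] ℝ) (c : ℝ) (u v : CSpace n) :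
    w ![c • u, v] = c * w ![u, v] := by
  have h := w.map_update_smul ![0, v] 0 c u
  have h1 : ∀ z : CSpace n, Function.update ![0, v] 0 z = ![z, v] := fun z => by
    ext i; fin_cases i <;> rfl
  simpa only [h1, smul_eq_mul] using h

lemma smul_right (w : CSpace n [⋀^Fin 2]→L[ℝ] ℝ) (c : ℝ) (u v : CSpace n) :
    w ![u, c • v] = c * w ![u, v] := by
  have h := w.map_update_smul ![u, 0] 1 c v
  have h1 : ∀ z : CSpace n, Function.update ![u, 0] 1 z = ![u, z] := fun z => by
    ext i; fin_cases i <;> rfl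
  simpa only [h1, smul_eq_mul] using h

lemma neg_right (w : CSpace n [⋀^Fin 2]→L[ℝ] ℝ) (u v : CSpace n) :
    w ![u, -v] = -w ![u, v] := by
  simpa using smul_right w (-1) u v

lemma swap (w : CSpace n [⋀^Fin 2]→L[ℝ] ℝ) (u v : CSpace n) : w ![u, v] = -w ![v, u] := by
  have h0 : ∀ z : CSpace n, w ![z, z] = 0 := fun z =>
    w.map_eq_zero_of_eq ![z, z] (i := 0) (j := 1) rfl (by decide)
  have h := h0 (u + v)
  rw [add_left, add_right, add_right, h0, h0] at h
  linarith

lemma I_smul_left (hw : IsPositiveOneOne n w) (u v : CSpace n) :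
    w ![Complex.I • u, v] = -w ![u, Complex.I • v] := by
  have h := hw.type_one_one u (Complex.I • v)
  rw [smul_smul, Complex.I_mul_I, neg_one_smul, neg_right] at h
  linarith

/-- The Hermitian form `ω(u, iv) - i ω(u, v)` associated with `ω`. -/
def hermitian (w : CSpace n [⋀^Fin 2]→L[ℝ] ℝ) (u v : CSpace n) : ℂ :=
  (w ![u, Complex.I • v] : ℂ) - Complex.I * w ![u, v]

lemma smul_eq (c : ℂ) (u : CSpace n) : c • u = c.re • u + c.im • (Complex.I • u) := by
  conv_lhs => rw [← Complex.re_add_im c, add_smul, mul_smul]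
  rfl

/-- The Hermitian form as a sesquilinear map. -/
def hermitianForm (hw : IsPositiveOneOne n w) : CSpace n →ₗ[ℂ] CSpace n →ₗ⋆[ℂ] ℂ :=
  LinearMap.mk₂'ₛₗ _ _ (hermitian w)
    (fun u u' v => by
      simp only [hermitian, add_left]; push_cast; ring)
    (fun c u v => by
      simp only [hermitian, smul_eq c u, add_left, smul_left, hw.I_smul_left, smul_smul,
        Complex.I_mul_I, neg_one_smul, neg_right, RingHom.id_apply, smul_eq_mul]
      push_cast
      conv_rhs => rw [← Complex.re_add_im c]
      linear_combination (c.im * w ![u, v]) * Complex.I_mul_I)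
    (fun u v v' => by
      simp only [hermitian, add_right, smul_add]; push_cast; ring)
    (fun c u v => by
      simp only [hermitian, smul_eq c v, smul_add, smul_comm Complex.I (_ : ℝ), add_right,
        smul_right, smul_smul, Complex.I_mul_I, neg_one_smul, neg_right, smul_eq_mul]
      push_cast
      have : conj c = c.re - c.im * Complex.I := by
        apply Complex.ext <;> simp
      rw [this]
      linear_combination (-(c.im * w ![u, v])) * Complex.I_mul_I)

open scoped ComplexOrder in
/-- The matrix of half the Hermitian form of a positive (1,1)-form is positive definite. -/
lemma posDef (hw : IsPositiveOneOne n w) :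
    (Matrix.of fun i j : Fin n => hermitian w (EuclideanSpace.single i 1)
      (EuclideanSpace.single j 1) / 2).PosDef := by
  have hherm : ∀ u v, star (hermitian w u v) = hermitian w v u := fun u v => by
    have h1 : w ![u, Complex.I • v] = w ![v, Complex.I • u] := by
      rw [swap, hw.I_smul_left, neg_neg]
    simp only [hermitian, star_sub, star_mul', Complex.star_def, Complex.conj_ofReal, Complex.conj_I]
    rw [h1, swap w u v]
    push_cast; ring
  refine Matrix.posDef_iff_dotProduct_mulVec.2 ⟨?_, fun {x} hx => ?_⟩
  · ext i j
    simp [Matrix.conjTranspose_apply, hherm, star_div₀]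
  -- The form is linear in its first argument and antilinear in its second, so the quadratic form of
  -- the matrix at x is the value at the conjugate vector.
  · set u : CSpace n := WithLp.toLp 2 (star x) with hu
    have hu0 : u ≠ 0 := fun h => hx (by
      have : star x = 0 := congrArg WithLp.ofLp h
      simpa using this)
    have hsum : u = ∑ i, star (x i) • (EuclideanSpace.single i (1 : ℂ) : CSpace n) := by
      ext j
      simp [hu, Finset.sum_apply, Pi.single_apply]
    have h2 : star x ⬝ᵥ ((Matrix.of fun i j : Fin n => hermitian w (EuclideanSpace.single i 1)
        (EuclideanSpace.single j 1) / 2).mulVec x) = hermitian w u u / 2 := by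
      change _ = hw.hermitianForm u u / 2
      conv_rhs => rw [hsum]
      simp only [map_sum, LinearMap.sum_apply, map_smul, map_smulₛₗ, LinearMap.smul_apply,
        Finset.sum_div, dotProduct, Matrix.mulVec, Finset.mul_sum, Matrix.of_apply, smul_eq_mul,
        Pi.star_apply, Complex.star_def, Complex.conj_conj]
      rw [Finset.sum_comm]
      refine Finset.sum_congr rfl fun i _ => Finset.sum_congr rfl fun j _ => ?_
      change _ = _ * (_ * hermitian w _ _) / 2
      ring
    have h3 : hermitian w u u = (w ![u, Complex.I • u] : ℂ) := by
      have : w ![u, u] = 0 := by have := swap w u u; linarith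
      simp [hermitian, this]
    rw [h2, h3]
    have := hw.pos u hu0
    have h4 : ((w ![u, Complex.I • u] : ℂ)) / 2 = ((w ![u, Complex.I • u] / 2 : ℝ) : ℂ) := by
      push_cast; rfl
    rw [h4]
    exact Complex.zero_lt_real.2 (by positivity)

end IsPositiveOneOne

-- The matrix `gMatrix` holds the values of half the Hermitian form on the standard basis, and a
-- positive definite matrix has positive determinant.
open scoped ComplexOrder in
lemma KahlerForm.liouvilleDensity_pos (K : KahlerForm n M)
    {e : OpenPartialHomeomorph M (CSpace n)} (he : e ∈ atlas (CSpace n) M) {y : CSpace n}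
    (hy : y ∈ e.target) : 0 < K.liouvilleDensity e y := by
  have h := (K.isPositiveOneOne_formInChart he hy).posDef.det_pos
  have hm : K.gMatrix e y = Matrix.of fun i j : Fin n =>
      IsPositiveOneOne.hermitian (formInChart K.form e y) (EuclideanSpace.single i 1)
        (EuclideanSpace.single j 1) / 2 := by
    ext i j
    have : (Complex.I • EuclideanSpace.single j 1 : CSpace n) =
        EuclideanSpace.single j Complex.I := by
      ext k; simp
    simp [KahlerForm.gMatrix, IsPositiveOneOne.hermitian, this]
  rw [← hm] at h
  exact mul_pos (by positivity) (Complex.pos_iff.1 h).1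

variable [T2Space M] [CompactSpace M] [MeasurableSpace M] [BorelSpace M]

/-- At a point of U some function of the partition is positive. The piece of the measure belonging
to it has positive density near that point, and the other pieces can only add mass. -/
instance KahlerForm.isOpenPosMeasure_liouville (K : KahlerForm n M) :
    K.liouville.IsOpenPosMeasure := by
  refine ⟨fun U hU ⟨x, hx⟩ => ?_⟩
  obtain ⟨p, hp⟩ : ∃ p, 0 < chartPartition n M p x := by
    obtain ⟨p, hp⟩ := (chartPartition n M).exists_pos_of_mem (mem_univ x)
    exact ⟨p, hp⟩
  set e := chartAt (CSpace n) p with he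
  have hxe : x ∈ e.source :=
    chartPartition_isSubordinate n M p (subset_tsupport _ hp.ne')
  have hmeas : AEMeasurable e.symm (K.liouvillePiece p) :=
    (e.continuousOn_symm.aemeasurable e.open_target.measurableSet).mono_ac
      (withDensity_absolutelyContinuous _ _)
  have hle : K.liouvillePiece p (e.symm ⁻¹' U) ≤ K.liouville U := by
    rw [← Measure.map_apply_of_aemeasurable hmeas hU.measurableSet, KahlerForm.liouville]
    exact Measure.le_sum (fun p : M => (K.liouvillePiece p).map (chartAt (CSpace n) p).symm) p U
  have hV : IsOpen (e.target ∩ e.symm ⁻¹' (U ∩ {z | 0 < chartPartition n M p z})) :=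
    e.isOpen_inter_preimage_symm
      (hU.inter (isOpen_lt continuous_const (chartPartition n M p).contMDiff.continuous))
  set V := e.target ∩ e.symm ⁻¹' (U ∩ {z | 0 < chartPartition n M p z})
  have hVne : V.Nonempty := ⟨e x, e.map_source hxe, by
    simp only [mem_preimage, e.left_inv hxe]; exact ⟨hx, hp⟩⟩
  have hVpos : 0 < K.liouvillePiece p V := by
    rw [KahlerForm.liouvillePiece, withDensity_apply _ hV.measurableSet,
      Measure.restrict_restrict hV.measurableSet, inter_eq_left.2 inter_subset_left]
    have hcont : ContinuousOn (fun y => ENNReal.ofReal (chartPartition n M p (e.symm y) *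
        K.liouvilleDensity e y)) V :=
      ENNReal.continuous_ofReal.comp_continuousOn
        ((((chartPartition n M p).contMDiff.continuous.comp_continuousOn e.continuousOn_symm).mul
          (K.continuousOn_liouvilleDensity (chart_mem_atlas _ _))).mono inter_subset_left)
    rw [pos_iff_ne_zero, Ne, setLIntegral_eq_zero_iff' hV.measurableSet
      (hcont.aemeasurable hV.measurableSet)]
    refine fun h => (hV.measure_pos volume hVne).ne'
      (measure_mono_null ?_ (ae_iff.1 h))
    intro y hy hy0
    exact (ENNReal.ofReal_pos.2 (mul_pos hy.2.2
      (K.liouvilleDensity_pos (chart_mem_atlas _ _) hy.1))).ne' (hy0 hy)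
  have : V ⊆ e.symm ⁻¹' U := fun y hy => hy.2.1
  exact (hVpos.trans_le ((measure_mono this).trans hle)).ne'

end LiouvillePositivity

/-! ### Polarization of sesquilinear identities. -/

section Polarization

variable {E : Type*} [NormedAddCommGroup E] [NormedSpace ℂ E]

/-- Polarization: a sesquilinear combination of holomorphic functions on a ball which vanishes on
the diagonal vanishes identically. -/
lemma sesquilinear_eq_zero_of_diagonal {ι : Type*} [Fintype ι] {c : E} {r : ℝ} {φ : ι → E → ℂ}
    (hφ : ∀ i, DifferentiableOn ℂ (φ i) (Metric.ball c r)) {C : ι → ι → ℂ}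
    (h : ∀ z ∈ Metric.ball c r, ∑ i, ∑ j, C i j * (conj (φ i z) * φ j z) = 0) {z w : E}
    (hz : z ∈ Metric.ball c r) (hw : w ∈ Metric.ball c r) :
    ∑ i, ∑ j, C i j * (conj (φ i w) * φ j z) = 0 := by
  -- The complex line t ↦ p + t q passes through z at t = i and through w at the conjugate parameter
  -- t = -i.
  set p : E := (1 / 2 : ℂ) • (z + w) with hp
  set q : E := (-Complex.I / 2) • (z - w) with hq
  have hpz : p + Complex.I • q = z := by
    rw [hp, hq, smul_smul, mul_div_assoc', mul_neg, Complex.I_mul_I]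
    module
  have hpw : p + conj Complex.I • q = w := by
    rw [hp, hq, smul_smul, Complex.conj_I, mul_div_assoc', neg_mul_neg, Complex.I_mul_I]
    module
  set V : Set ℂ := {t | p + t • q ∈ Metric.ball c r} with hV
  have hVo : IsOpen V := Metric.isOpen_ball.preimage (by fun_prop)
  have hVc : Convex ℝ V := by
    intro a ha b hb u v hu hv huv
    have := (convex_ball c r) ha hb hu hv huv
    have e : p + (u • a + v • b) • q = u • (p + a • q) + v • (p + b • q) := by
      have : p = (u + v) • p := by rw [huv, one_smul]
      conv_lhs => rw [this]
      rw [add_smul, add_smul, smul_add, smul_add, smul_assoc, smul_assoc]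
      abel
    rw [hV, mem_ofPred_eq, e]
    exact this
  -- The function below evaluates φ at both t and its conjugate, hence the symmetric domain. It is
  -- convex, so connected, and contains 0 as the midpoint of i and -i.
  set U : Set ℂ := V ∩ conj ⁻¹' V with hU
  have hUo : IsOpen U := hVo.inter (hVo.preimage Complex.continuous_conj)
  have hUc : Convex ℝ U := hVc.inter
    (hVc.linear_preimage (Complex.conjAe.toLinearMap : ℂ →ₗ[ℝ] ℂ))
  have hIU : Complex.I ∈ U := ⟨by rw [hV, mem_ofPred_eq, hpz]; exact hz, by
    rw [mem_preimage, hV, mem_ofPred_eq, hpw]; exact hw⟩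
  have hIU' : -Complex.I ∈ U := by
    refine ⟨?_, ?_⟩
    · have := hIU.2; rwa [mem_preimage, Complex.conj_I] at this
    · rw [mem_preimage, map_neg, Complex.conj_I, neg_neg]; exact hIU.1
  have h0U : (0 : ℂ) ∈ U := by
    have := hUc hIU hIU' (a := 1 / 2) (b := 1 / 2) (by norm_num) (by norm_num) (by norm_num)
    simpa using this
  have hd : ∀ i, ∀ t ∈ V, DifferentiableAt ℂ (fun t : ℂ => φ i (p + t • q)) t := fun i t ht =>
    ((hφ i).differentiableAt (Metric.isOpen_ball.mem_nhds ht)).comp t (by fun_prop)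
  have hd' : ∀ i, ∀ t ∈ U, DifferentiableAt ℂ (fun t : ℂ => conj (φ i (p + conj t • q))) t :=
    fun i t ht => by
      have := (hd i _ ht.2).conj_conj
      rwa [Complex.conj_conj] at this
  -- Two conjugations cancel, so g is holomorphic. On real t it is the diagonal expression, which is
  -- zero; at t = i it is the sum to be computed. The identity theorem links the two.
  set g : ℂ → ℂ := fun t =>
    ∑ i, ∑ j, C i j * (conj (φ i (p + conj t • q)) * φ j (p + t • q)) with hg
  have hgd : DifferentiableOn ℂ g U := fun t ht =>
    (DifferentiableAt.fun_sum fun i _ => DifferentiableAt.fun_sum fun j _ =>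
      ((hd' i t ht).mul (hd j t ht.1)).const_mul (C i j)).differentiableWithinAt
  have hreal : ∀ t : ℝ, (t : ℂ) ∈ U → g t = 0 := fun t ht => by
    simp only [hg, Complex.conj_ofReal]
    exact h _ ht.1
  have hfreq : ∃ᶠ t in 𝓝[≠] (0 : ℂ), g t = 0 := by
    have htend : Filter.Tendsto (fun t : ℝ => (t : ℂ)) (𝓝[≠] 0) (𝓝[≠] 0) :=
      tendsto_nhdsWithin_iff.2 ⟨(Complex.continuous_ofReal.tendsto' 0 0 (by simp)).mono_left
        nhdsWithin_le_nhds, by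
        filter_upwards [self_mem_nhdsWithin] with t ht
        simpa using ht⟩
    refine htend.frequently (Filter.Eventually.frequently ?_)
    have h1 : ∀ᶠ t : ℝ in 𝓝[≠] 0, (t : ℂ) ∈ U :=
      htend.eventually (nhdsWithin_le_nhds (hUo.mem_nhds h0U))
    filter_upwards [h1] with t ht using hreal t ht
  have := (hgd.analyticOnNhd hUo).eqOn_zero_of_preconnected_of_frequently_eq_zero
    hUc.isPreconnected h0U hfreq hIU
  simpa only [hg, hpz, hpw, Pi.zero_apply] using this

end Polarization

/-! ### Sections in local coordinates and the identity theorem. -/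

section LocalCoordinates

variable {n : ℕ} {M : Type*} [TopologicalSpace M] [ChartedSpace (CSpace n) M]
  {L : M → Type*} [∀ x, AddCommGroup (L x)] [∀ x, Module ℂ (L x)] [∀ x, TopologicalSpace (L x)]
  [TopologicalSpace (TotalSpace ℂ L)] [FiberBundle ℂ L] [VectorBundle ℂ ℂ L]

/-- The tensor power of the inverse of the fibrewise trivialization is a left inverse. -/
lemma tensorCoord_injective (e : Trivialization ℂ (π ℂ L)) [MemTrivializationAtlas e] (m : ℕ)
    {x : M} (hx : x ∈ e.baseSet) : Function.Injective (tensorCoord e m x) := by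
  have h : (PiTensorProduct.map fun _ : Fin m => e.symmₗ ℂ x) ∘ₗ
      (PiTensorProduct.map fun _ : Fin m => e.linearMapAt ℂ x) = LinearMap.id := by
    rw [← PiTensorProduct.map_comp, ← PiTensorProduct.map_id]
    congr 1
    funext _
    exact LinearMap.ext fun v => e.symmₗ_linearMapAt hx v
  have h' : Function.Injective (PiTensorProduct.map fun _ : Fin m => e.linearMapAt ℂ x) :=
    Function.LeftInverse.injective fun v => LinearMap.congr_fun h v
  exact (PiTensorProduct.constantBaseRingEquiv (Fin m) ℂ).injective.comp h'

namespace HermitianMetric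

variable (h : HermitianMetric n L)

lemma local_pos (e : Trivialization ℂ (π ℂ L)) [MemTrivializationAtlas e] {x : M}
    (hx : x ∈ e.baseSet) : 0 < h.local e x := by
  refine h.pos x _ fun h0 => one_ne_zero (α := ℂ) ?_
  have := e.linearMapAt_symmₗ (R := ℂ) hx 1
  rw [e.coe_symmₗ hx, h0, map_zero] at this
  exact this.symm

lemma conj_tensorMetric (m : ℕ) (x : M)
    (s t : TensorFiber L m x) : conj (h.tensorMetric m x s t) = h.tensorMetric m x t s := by
  simp only [HermitianMetric.tensorMetric, map_mul, map_pow, Complex.conj_conj,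
    Complex.conj_ofReal]
  ring

/-- The squared pointwise length of an element of a fibre of `L^m`. -/
def tensorNormSq (m : ℕ) (x : M) (v : TensorFiber L m x) : ℝ := (h.tensorMetric m x v v).re

lemma tensorNormSq_eq (e : Trivialization ℂ (π ℂ L)) [MemTrivializationAtlas e] (m : ℕ) {x : M}
    (hx : x ∈ e.baseSet) (v : TensorFiber L m x) :
    h.tensorNormSq m x v = ‖tensorCoord e m x v‖ ^ 2 * h.local e x ^ m := by
  rw [tensorNormSq, h.tensorMetric_eq e m hx, ← Complex.normSq_eq_conj_mul_self,
    ← Complex.normSq_eq_norm_sq]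
  norm_cast

lemma tensorNormSq_nonneg (m : ℕ) (x : M) (v : TensorFiber L m x) :
    0 ≤ h.tensorNormSq m x v := by
  have hx := mem_baseSet_trivializationAt ℂ L x
  rw [h.tensorNormSq_eq _ m hx]
  exact mul_nonneg (sq_nonneg _) (pow_nonneg (h.local_pos _ hx).le _)

lemma eq_zero_of_tensorNormSq {m : ℕ} {x : M} {v : TensorFiber L m x}
    (hv : h.tensorNormSq m x v = 0) : v = 0 := by
  have hx := mem_baseSet_trivializationAt ℂ L x
  rw [h.tensorNormSq_eq _ m hx] at hv
  have := (mul_eq_zero.1 hv).resolve_right (pow_pos (h.local_pos _ hx) m).ne'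
  exact tensorCoord_injective _ m hx (by simpa using this)

lemma contMDiff_tensorMetric {m : ℕ} {s t : ∀ x, TensorFiber L m x}
    (hs : IsSmoothTensorSection n m s) (ht : IsSmoothTensorSection n m t) :
    ContMDiff 𝓘(ℝ, CSpace n) 𝓘(ℝ, ℂ) ∞ fun x => h.tensorMetric m x (s x) (t x) := by
  intro x
  set e := trivializationAt ℂ L x
  have hmem : e.baseSet ∈ 𝓝 x := e.open_baseSet.mem_nhds (mem_baseSet_trivializationAt ℂ L x)
  have hF : ContDiff ℝ ∞ fun y : (ℂ × ℂ) × ℝ => conj y.1.1 * y.1.2 * (y.2 : ℂ) ^ m :=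
    ((Complex.conjCLE.contDiff.comp (contDiff_fst.comp contDiff_fst)).mul
      (contDiff_snd.comp contDiff_fst)).mul ((Complex.ofRealCLM.contDiff.comp contDiff_snd).pow m)
  have h1 : ContMDiffAt 𝓘(ℝ, CSpace n) 𝓘(ℝ, (ℂ × ℂ) × ℝ) ∞
      (fun y => ((tensorCoord e m y (s y), tensorCoord e m y (t y)), h.local e y)) x :=
    (((hs e).contMDiffAt hmem).prodMk_space ((ht e).contMDiffAt hmem)).prodMk_space
      ((h.smooth e).contMDiffAt hmem)
  refine (hF.contMDiff.contMDiffAt.comp x h1).congr_of_eventuallyEq ?_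
  filter_upwards [hmem] with y hy
  exact h.tensorMetric_eq e m hy _ _

end HermitianMetric

/-- The coordinate expression of a section of `L^m` in the preferred chart and frame at `p`. -/
def localCoord (n : ℕ) [ChartedSpace (CSpace n) M] {m : ℕ} (s : ∀ x, TensorFiber L m x) (p : M)
    (z : CSpace n) : ℂ :=
  tensorCoord (trivializationAt ℂ L p) m ((chartAt (CSpace n) p).symm z)
    (s ((chartAt (CSpace n) p).symm z))

/-- Small coordinate balls are contained in a given neighbourhood. -/
lemma exists_coordinate_ball {p : M} {U : Set M} (hU : U ∈ 𝓝 p) :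
    ∃ r > 0, Metric.ball (chartAt (CSpace n) p p) r ⊆
      (chartAt (CSpace n) p).target ∩ (chartAt (CSpace n) p).symm ⁻¹' U := by
  set e := chartAt (CSpace n) p
  have hp : p ∈ e.source := mem_chart_source _ p
  refine Metric.mem_nhds_iff.1 (Filter.inter_mem
    (e.open_target.mem_nhds (e.map_source hp)) ?_)
  have hc := e.continuousAt_symm (e.map_source hp)
  exact hc.preimage_mem_nhds (by rwa [e.left_inv hp])

lemma coordinate_ball_mem_nhds (p : M) {r : ℝ} (hr : 0 < r) :
    (chartAt (CSpace n) p).source ∩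
      chartAt (CSpace n) p ⁻¹' Metric.ball (chartAt (CSpace n) p p) r ∈ 𝓝 p :=
  Filter.inter_mem (chart_source_mem_nhds _ p)
    (((chartAt (CSpace n) p).continuousAt (mem_chart_source _ p)).preimage_mem_nhds
      (Metric.ball_mem_nhds _ hr))

variable [IsManifold 𝓘(ℂ, CSpace n) ω M]

lemma contDiffOn_localCoord {m : ℕ} {s : ∀ x, TensorFiber L m x}
    (hs : IsHolomorphicTensorSection n m s) (p : M) :
    ContDiffOn ℂ ω (localCoord n s p) ((chartAt (CSpace n) p).target ∩
      (chartAt (CSpace n) p).symm ⁻¹' (trivializationAt ℂ L p).baseSet) := by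
  have h1 : ContMDiffOn 𝓘(ℂ, CSpace n) 𝓘(ℂ, CSpace n) ω (chartAt (CSpace n) p).symm
      (chartAt (CSpace n) p).target := contMDiffOn_chart_symm
  have h2 := (hs (trivializationAt ℂ L p)).comp' h1
  exact contMDiffOn_iff_contDiffOn.1 h2

/-- The identity theorem for holomorphic sections. -/
lemma IsHolomorphicTensorSection.eq_zero_of_eventually [PreconnectedSpace M] {m : ℕ}
    {s : ∀ x, TensorFiber L m x} (hs : IsHolomorphicTensorSection n m s) {p : M}
    (hp : ∀ᶠ x in 𝓝 p, s x = 0) (x : M) : s x = 0 := by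
  set Z : Set M := {x | ∀ᶠ y in 𝓝 x, s y = 0} with hZ
  have hZo : IsOpen Z := isOpen_iff_mem_nhds.2 fun x hx => eventually_eventually_nhds.2 hx
  have hZc : IsClosed Z := by
    refine isClosed_of_closure_subset fun x hx => ?_
    set e := chartAt (CSpace n) x
    set τ := trivializationAt ℂ L x
    obtain ⟨r, hr, hball⟩ := exists_coordinate_ball (n := n) (U := τ.baseSet)
      (τ.open_baseSet.mem_nhds (mem_baseSet_trivializationAt ℂ L x))
    set W := e.source ∩ e ⁻¹' Metric.ball (e x) r with hW
    have hWx : W ∈ 𝓝 x := coordinate_ball_mem_nhds x hr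
    -- The coordinate function vanishes near the image of this y, hence on the whole ball, which
    -- also contains the image of x.
    obtain ⟨y, hyW, hyZ⟩ := mem_closure_iff_nhds.1 hx W hWx
    have hφ : EqOn (localCoord n s x) 0 (Metric.ball (e x) r) := by
      refine AnalyticOnNhd.eqOn_zero_of_preconnected_of_eventuallyEq_zero (𝕜 := ℂ) (z₀ := e y)
        ?_ (convex_ball (e x) r).isPreconnected hyW.2 ?_
      · exact Metric.isOpen_ball.analyticOn_iff_analyticOnNhd.1
          ((contDiffOn_localCoord hs x).mono hball).analyticOn
      · have hc := e.continuousAt_symm (e.map_source hyW.1)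
        rw [ContinuousAt, e.left_inv hyW.1] at hc
        filter_upwards [hc.eventually hyZ] with z hz
        simp only [localCoord, Pi.zero_apply]
        rw [hz, map_zero]
    refine Filter.mem_of_superset hWx fun y hy => ?_
    have h0 := hφ hy.2
    have hyb := (hball hy.2).2
    simp only [localCoord, Pi.zero_apply, mem_preimage] at h0 hyb
    rw [e.left_inv hy.1] at h0 hyb
    exact tensorCoord_injective τ m hyb (h0.trans (map_zero _).symm)
  have : Z = univ := IsClopen.eq_univ ⟨hZc, hZo⟩ ⟨p, hp⟩
  have hx : x ∈ Z := this ▸ mem_univ x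
  exact hx.self_of_nhds

end LocalCoordinates

/-! ### Finite dimension, and independence of the pointwise products. -/

section HolomorphicSections

variable {n : ℕ} {M : Type*} [TopologicalSpace M] [ChartedSpace (CSpace n) M]
  [IsManifold 𝓘(ℂ, CSpace n) ω M]
  {L : M → Type*} [∀ x, AddCommGroup (L x)] [∀ x, Module ℂ (L x)] [∀ x, TopologicalSpace (L x)]
  [TopologicalSpace (TotalSpace ℂ L)] [FiberBundle ℂ L] [VectorBundle ℂ ℂ L]
  {K : KahlerForm n M}

/-- The Schwarz lemma for sections: close to a zero, a holomorphic section is much smaller than its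
maximum, uniformly in the section. -/
lemma HermitianMetric.exists_nhds_tensorNormSq_le (h : HermitianMetric n L) (m : ℕ) (p : M) :
    ∃ U ∈ 𝓝 p, ∀ s : ∀ x, TensorFiber L m x, IsHolomorphicTensorSection n m s → s p = 0 →
      ∀ B : ℝ, (∀ x, h.tensorNormSq m x (s x) ≤ B) →
        ∀ x ∈ U, h.tensorNormSq m x (s x) ≤ B / 4 := by
  set e := chartAt (CSpace n) p with he
  set τ := trivializationAt ℂ L p with hτ
  have hpτ : p ∈ τ.baseSet := mem_baseSet_trivializationAt ℂ L p
  set c := h.local τ p with hc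
  have hc0 : 0 < c := h.local_pos τ hpτ
  have hcont : ContinuousAt (h.local τ) p :=
    (h.smooth τ).continuousOn.continuousAt (τ.open_baseSet.mem_nhds hpτ)
  -- Here ĥ varies by a factor of at most 4, so passing from the coordinate to the length in L^m and
  -- back costs at most 4^m.
  have hU : τ.baseSet ∩ h.local τ ⁻¹' Ioo (c / 2) (2 * c) ∈ 𝓝 p :=
    Filter.inter_mem (τ.open_baseSet.mem_nhds hpτ)
      (hcont.preimage_mem_nhds (Ioo_mem_nhds (by linarith) (by linarith)))
  obtain ⟨r, hr, hball⟩ := exists_coordinate_ball (n := n) hU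
  -- The Schwarz lemma gains 2^(m+1), whose square 4^(m+1) absorbs the loss 4^m and leaves the
  -- factor 1/4.
  refine ⟨_, coordinate_ball_mem_nhds (n := n) p (r := r / 2 ^ (m + 1)) (by positivity),
    fun s hs hsp B hB x hx => ?_⟩
  have hB0 : 0 ≤ B := (h.tensorNormSq_nonneg m p _).trans (hB p)
  set R := Real.sqrt (B / (c / 2) ^ m) with hR
  have hφ : ∀ z ∈ Metric.ball (e p) r, ‖localCoord n s p z‖ ≤ R := fun z hz => by
    obtain ⟨-, hzτ, hzc⟩ := hball hz
    refine Real.le_sqrt_of_sq_le ((le_div_iff₀ (by positivity)).2 ?_)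
    refine le_trans ?_ (hB (e.symm z))
    rw [h.tensorNormSq_eq τ m hzτ]
    exact mul_le_mul_of_nonneg_left (pow_le_pow_left₀ (by positivity) hzc.1.le m) (sq_nonneg _)
  have hz0 : localCoord n s p (e p) = 0 := by
    have : e.symm (e p) = p := e.left_inv (mem_chart_source _ p)
    simp only [localCoord]
    rw [this, hsp, map_zero]
  have hxr : dist (e x) (e p) < r / 2 ^ (m + 1) := hx.2
  have hxball : e x ∈ Metric.ball (e p) r :=
    hxr.trans_le (div_le_self hr.le (one_le_pow₀ (by norm_num)))
  have hschwarz := Complex.dist_le_div_mul_dist_of_mapsTo_ball (R₂ := R)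
    (((contDiffOn_localCoord hs p).differentiableOn (by simp)).mono
      (hball.trans (inter_subset_inter_right _ (preimage_mono inter_subset_left))))
    (fun z hz => by rw [hz0]; simpa using hφ z hz) hxball
  rw [hz0, dist_zero_right] at hschwarz
  have hφx : ‖localCoord n s p (e x)‖ ≤ R / 2 ^ (m + 1) := by
    refine hschwarz.trans ((mul_le_mul_of_nonneg_left hxr.le (by positivity)).trans_eq ?_)
    field_simp
  have hex : e.symm (e x) = x := e.left_inv hx.1
  have hxU : e.symm (e x) ∈ τ.baseSet ∩ h.local τ ⁻¹' Ioo (c / 2) (2 * c) := (hball hxball).2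
  rw [hex] at hxU
  obtain ⟨hxτ, hxc⟩ := hxU
  rw [h.tensorNormSq_eq τ m hxτ]
  have h1 : tensorCoord τ m x (s x) = localCoord n s p (e x) := by
    simp only [localCoord, ← hτ]
    rw [hex]
  rw [h1]
  calc ‖localCoord n s p (e x)‖ ^ 2 * h.local τ x ^ m
      ≤ (R / 2 ^ (m + 1)) ^ 2 * (2 * c) ^ m :=
        mul_le_mul (pow_le_pow_left₀ (norm_nonneg _) hφx 2)
          (pow_le_pow_left₀ (h.local_nonneg τ x) hxc.2.le m)
          (pow_nonneg (h.local_nonneg τ x) m) (by positivity)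
    _ = B / 4 := by
        rw [div_pow, hR, Real.sq_sqrt (by positivity), div_pow, mul_pow]
        have : ((2 : ℝ) ^ (m + 1)) ^ 2 = 4 * (2 ^ m * 2 ^ m) := by ring
        rw [this]
        field_simp

variable (Q : QuantumLineBundle L K) (m : ℕ)

/-- The space of holomorphic sections of a power of a line bundle on a compact complex manifold is
finite-dimensional. -/
instance finiteDimensional_holomorphicSections [CompactSpace M] :
    FiniteDimensional ℂ (holomorphicSections Q m) := by
  choose U hU hsmall using fun p : M => Q.metric.exists_nhds_tensorNormSq_le m p
  obtain ⟨t, ht⟩ := CompactSpace.elim_nhds_subcover U hU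
  -- Evaluation at the finitely many centres is injective: if a section vanishes at all of them, the
  -- maximum of its squared length is at most a quarter of itself.
  let ev : holomorphicSections Q m →ₗ[ℂ] (t → ℂ) :=
    LinearMap.pi fun p =>
      { toFun := fun s => tensorCoord (trivializationAt ℂ L p.1) m p.1
          ((s : SmoothSections Q m).val p.1)
        map_add' := fun s s' => map_add _ _ _
        map_smul' := fun c s => map_smul _ c _ }
  refine FiniteDimensional.of_injective ev ((injective_iff_map_eq_zero ev).2 fun s hs => ?_)
  have hs0 : ∀ p ∈ t, (s : SmoothSections Q m).val p = 0 := fun p hp =>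
    tensorCoord_injective _ m (mem_baseSet_trivializationAt ℂ L p)
      ((congrFun hs ⟨p, hp⟩).trans (map_zero _).symm)
  have hzero : ∀ x, Q.metric.tensorNormSq m x ((s : SmoothSections Q m).val x) = 0 := by
    intro x
    have hcont : Continuous fun x =>
        Q.metric.tensorNormSq m x ((s : SmoothSections Q m).val x) :=
      Complex.continuous_re.comp
        (Q.metric.continuous_tensorMetric s.1.smooth s.1.smooth)
    obtain ⟨x₀, -, hx₀⟩ := isCompact_univ.exists_isMaxOn ⟨x, mem_univ x⟩ hcont.continuousOn
    have hmax : ∀ y, Q.metric.tensorNormSq m y ((s : SmoothSections Q m).val y) ≤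
        Q.metric.tensorNormSq m x₀ ((s : SmoothSections Q m).val x₀) := fun y => hx₀ (mem_univ y)
    obtain ⟨p, hp, hpx⟩ := mem_iUnion₂.1 (ht ▸ mem_univ x₀ : x₀ ∈ ⋃ p ∈ t, U p)
    have h1 := hsmall p _ s.2 (hs0 p hp) _ hmax x₀ hpx
    have h2 := Q.metric.tensorNormSq_nonneg m x ((s : SmoothSections Q m).val x)
    linarith [hmax x]
  exact Subtype.ext (Subtype.ext (funext fun x => Q.metric.eq_zero_of_tensorNormSq (hzero x)))

variable {Q m}

/-- The pointwise scalar products of linearly independent holomorphic sections are linearly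
independent functions. -/
lemma eq_zero_of_sum_tensorMetric_eq_zero [ConnectedSpace M] {ι : Type*} [Fintype ι]
    {b : ι → holomorphicSections Q m} (hb : LinearIndependent ℂ b) {C : ι → ι → ℂ}
    (hC : ∀ x, ∑ i, ∑ j, C i j * Q.metric.tensorMetric m x ((b i : SmoothSections Q m).val x)
      ((b j : SmoothSections Q m).val x) = 0) : C = 0 := by
  obtain ⟨p⟩ : Nonempty M := inferInstance
  set e := chartAt (CSpace n) p with he
  set τ := trivializationAt ℂ L p with hτ
  have hpτ : p ∈ τ.baseSet := mem_baseSet_trivializationAt ℂ L p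
  obtain ⟨r, hr, hball⟩ := exists_coordinate_ball (n := n) (τ.open_baseSet.mem_nhds hpτ)
  set φ : ι → CSpace n → ℂ := fun i => localCoord n (b i : SmoothSections Q m).val p with hφ
  have hφd : ∀ i, DifferentiableOn ℂ (φ i) (Metric.ball (e p) r) := fun i =>
    ((contDiffOn_localCoord (b i).2 p).differentiableOn (by simp)).mono hball
  have hdiag : ∀ z ∈ Metric.ball (e p) r, ∑ i, ∑ j, C i j * (conj (φ i z) * φ j z) = 0 := by
    intro z hz
    have hzτ : e.symm z ∈ τ.baseSet := (hball hz).2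
    have h := hC (e.symm z)
    simp only [Q.metric.tensorMetric_eq τ m hzτ, ← mul_assoc, ← Finset.sum_mul] at h
    have h0 : ((Q.metric.local τ (e.symm z) : ℂ)) ^ m ≠ 0 :=
      pow_ne_zero m (Complex.ofReal_ne_zero.2 (Q.metric.local_pos τ hzτ).ne')
    simp only [← mul_assoc]
    exact (mul_eq_zero.1 h).resolve_right h0
  -- A linear relation on one ball holds on all of M by the identity theorem.
  have hindep : ∀ a : ι → ℂ, (∀ z ∈ Metric.ball (e p) r, ∑ j, a j * φ j z = 0) → a = 0 := by
    intro a ha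
    have hval : ∀ x, (∑ j, a j • b j : holomorphicSections Q m).1.val x =
        ∑ j, a j • (b j : SmoothSections Q m).val x := fun x => by
      let ev : holomorphicSections Q m →ₗ[ℂ] TensorFiber L m x :=
        { toFun := fun s => s.1.val x
          map_add' := fun _ _ => rfl
          map_smul' := fun _ _ => rfl }
      change ev _ = ∑ j, a j • ev (b j)
      rw [map_sum]
      simp only [map_smul]
    have hsum : ∑ j, a j • b j = 0 := by
      refine Subtype.ext (Subtype.ext (funext fun x => ?_))
      refine IsHolomorphicTensorSection.eq_zero_of_eventually (∑ j, a j • b j).2 (p := p) ?_ x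
      filter_upwards [coordinate_ball_mem_nhds (n := n) p hr] with y hy
      have hey : e.symm (e y) = y := e.left_inv hy.1
      have hyτ : y ∈ τ.baseSet := by
        have := (hball hy.2).2
        rwa [mem_preimage, hey] at this
      refine tensorCoord_injective τ m hyτ ?_
      rw [hval, map_sum, map_zero]
      have := ha (e y) hy.2
      simp only [hφ, localCoord, ← hτ] at this
      rw [hey] at this
      simpa only [map_smul, smul_eq_mul] using this
    exact funext fun j => Fintype.linearIndependent_iff.1 hb a hsum j
  -- For fixed w the polarized identity is a linear relation in z. Conjugating the result gives a
  -- relation in w, and independence applies a second time.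
  have h1 : ∀ w ∈ Metric.ball (e p) r, ∀ j, ∑ i, C i j * conj (φ i w) = 0 := by
    intro w hw j
    refine congrFun (hindep (fun j => ∑ i, C i j * conj (φ i w)) fun z hz => ?_) j
    have := sesquilinear_eq_zero_of_diagonal hφd hdiag hz hw
    rw [Finset.sum_comm] at this
    simpa only [Finset.sum_mul, mul_assoc] using this
  funext i j
  have h2 := congrFun (hindep (fun i => conj (C i j)) fun w hw => by
    have := congrArg conj (h1 w hw j)
    simpa only [map_sum, map_mul, Complex.conj_conj, map_zero] using this) i
  simpa using h2

end HolomorphicSections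

/-! ### Toeplitz operators and their matrix elements. -/

section Toeplitz

variable {n : ℕ} {M : Type*} [TopologicalSpace M] [ChartedSpace (CSpace n) M]
  [IsManifold 𝓘(ℂ, CSpace n) ω M]
  {L : M → Type*} [∀ x, AddCommGroup (L x)] [∀ x, Module ℂ (L x)] [∀ x, TopologicalSpace (L x)]
  [TopologicalSpace (TotalSpace ℂ L)] [FiberBundle ℂ L] [VectorBundle ℂ ℂ L]
  {K : KahlerForm n M} [T2Space M] [CompactSpace M] [MeasurableSpace M] [BorelSpace M]
  {Q : QuantumLineBundle L K} {m : ℕ}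

namespace SmoothSections

lemma inner_def (s t : SmoothSections Q m) :
    inner ℂ s t = ∫ x, Q.metric.tensorMetric m x (s.val x) (t.val x) ∂K.liouville := rfl

lemma inner_mul (f : C^∞⟮𝓘(ℝ, CSpace n), M; 𝓘(ℝ, ℂ), ℂ⟯) (s t : SmoothSections Q m) :
    inner ℂ s (mul f t) =
      ∫ x, f x * Q.metric.tensorMetric m x (s.val x) (t.val x) ∂K.liouville := by
  rw [inner_def]
  refine integral_congr_ae (Filter.Eventually.of_forall fun x => ?_)
  have : (mul f t).val x = f x • t.val x := rfl
  simp only [this, HermitianMetric.tensorMetric, map_smul, smul_eq_mul]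
  ring

/-- Multiplication by a function as a linear map. -/
def mulLinear (f : C^∞⟮𝓘(ℝ, CSpace n), M; 𝓘(ℝ, ℂ), ℂ⟯) :
    SmoothSections Q m →ₗ[ℂ] SmoothSections Q m where
  toFun := mul f
  map_add' s t := Subtype.ext (funext fun x => smul_add (f x) (s.val x) (t.val x))
  map_smul' c s := Subtype.ext (funext fun x => smul_comm (f x) c (s.val x))

end SmoothSections

/-- An operator is the Toeplitz operator of `f` if it has the same matrix elements. -/
lemma isToeplitzOperator_of_inner_eq {A : Module.End ℂ (holomorphicSections Q m)}
    {f : C^∞⟮𝓘(ℝ, CSpace n), M; 𝓘(ℝ, ℂ), ℂ⟯}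
    (h : ∀ s t : holomorphicSections Q m,
      inner ℂ (t : SmoothSections Q m) (SmoothSections.mul f s) =
        inner ℂ (t : SmoothSections Q m) (A s : SmoothSections Q m)) :
    IsToeplitzOperator A f := by
  intro s
  have hmem : ((A s : SmoothSections Q m) : L2Sections Q m) ∈ holomorphicL2 Q m :=
    Submodule.mem_map.2 ⟨_, (A s).2, rfl⟩
  -- The projection of f s is characterized by lying in the closed subspace and differing from f s
  -- by a vector orthogonal to it.
  refine (Submodule.eq_starProjection_of_mem_orthogonal
    (Submodule.le_topologicalClosure _ hmem) ?_).symm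
  rw [Submodule.orthogonal_closure, Submodule.mem_orthogonal]
  rintro _ ⟨t, ht, rfl⟩
  change inner ℂ (t : L2Sections Q m) _ = 0
  rw [inner_sub_right, UniformSpace.Completion.inner_coe, UniformSpace.Completion.inner_coe,
    h s ⟨t, ht⟩, sub_self]

/-- Matrix elements determine a linear map into the smooth sections up to orthogonality. -/
lemma inner_eq_of_basis {ι : Type*} (b : Module.Basis ι ℂ (holomorphicSections Q m))
    {S T : holomorphicSections Q m →ₗ[ℂ] SmoothSections Q m}
    (h : ∀ i j, inner ℂ (b i : SmoothSections Q m) (S (b j)) =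
      inner ℂ (b i : SmoothSections Q m) (T (b j))) (s t : holomorphicSections Q m) :
    inner ℂ (t : SmoothSections Q m) (S s) = inner ℂ (t : SmoothSections Q m) (T s) := by
  have h1 : ∀ i, ∀ s, inner ℂ (b i : SmoothSections Q m) (S s) =
      inner ℂ (b i : SmoothSections Q m) (T s) := fun i s =>
    LinearMap.congr_fun (b.ext (f₁ := innerₛₗ ℂ (b i : SmoothSections Q m) ∘ₗ S)
      (f₂ := innerₛₗ ℂ (b i : SmoothSections Q m) ∘ₗ T) fun j => h i j) s
  have h2 : innerₛₗ ℂ (S s) ∘ₗ (holomorphicSections Q m).subtype =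
      innerₛₗ ℂ (T s) ∘ₗ (holomorphicSections Q m).subtype := b.ext fun i => by
    have := congrArg conj (h1 i s)
    rwa [inner_conj_symm, inner_conj_symm] at this
  have := congrArg conj (LinearMap.congr_fun h2 t)
  change conj (inner ℂ (S s) (t : SmoothSections Q m)) =
    conj (inner ℂ (T s) (t : SmoothSections Q m)) at this
  rwa [inner_conj_symm, inner_conj_symm] at this

/-! ### Prescribing matrix elements by a symbol. -/

section Symbols

variable {ι : Type*} [Fintype ι] (b : ι → holomorphicSections Q m)

/-- The function `∑ C i j h(b i, b j)`. -/
def covariantSymbol (C : Matrix ι ι ℂ) (x : M) : ℂ :=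
  ∑ i, ∑ j, C i j * Q.metric.tensorMetric m x ((b i : SmoothSections Q m).val x)
    ((b j : SmoothSections Q m).val x)

omit [T2Space M] [CompactSpace M] [MeasurableSpace M] [BorelSpace M] in
lemma contMDiff_covariantSymbol (C : Matrix ι ι ℂ) :
    ContMDiff 𝓘(ℝ, CSpace n) 𝓘(ℝ, ℂ) ∞ (covariantSymbol b C) := by
  refine contMDiff_finsetSum fun i _ => contMDiff_finsetSum fun j _ => ?_
  have h := Q.metric.contMDiff_tensorMetric (b i : SmoothSections Q m).smooth
    (b j : SmoothSections Q m).smooth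
  have hc : ContMDiff 𝓘(ℝ, ℂ) 𝓘(ℝ, ℂ) ∞ fun z : ℂ => C i j * z :=
    (contDiff_const.mul contDiff_id).contMDiff
  exact hc.comp h

-- Conjugation swaps the arguments of the metric. Thus pairing C with its conjugate transpose yields
-- a squared L² norm.
omit [T2Space M] [CompactSpace M] [MeasurableSpace M] [BorelSpace M] in
lemma covariantSymbol_conjTranspose (C : Matrix ι ι ℂ) (x : M) :
    covariantSymbol b C.conjTranspose x = conj (covariantSymbol b C x) := by
  simp only [covariantSymbol, map_sum, map_mul, Q.metric.conj_tensorMetric,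
    Matrix.conjTranspose_apply]
  rw [Finset.sum_comm]
  rfl

lemma integrable_mul_covariantSymbol {f : M → ℂ} (hf : Continuous f) (C : Matrix ι ι ℂ) :
    Integrable (fun x => f x * covariantSymbol b C x) K.liouville :=
  (hf.mul (contMDiff_covariantSymbol b C).continuous).integrable_of_hasCompactSupport
    (HasCompactSupport.of_compactSpace _)

/-- The bilinear form `∫ (∑ C i j h(b i, b j)) (∑ D i j h(b i, b j)) Ω`. -/
def symbolPairing : Matrix ι ι ℂ →ₗ[ℂ] Module.Dual ℂ (Matrix ι ι ℂ) :=
  LinearMap.mk₂ ℂ (fun C D => ∫ x, covariantSymbol b C x * covariantSymbol b D x ∂K.liouville)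
    (fun C C' D => by
      rw [← integral_add (integrable_mul_covariantSymbol b
        (contMDiff_covariantSymbol b C).continuous D) (integrable_mul_covariantSymbol b
        (contMDiff_covariantSymbol b C').continuous D)]
      simp only [covariantSymbol, Matrix.add_apply, add_mul, Finset.sum_add_distrib])
    (fun c C D => by
      rw [smul_eq_mul, ← integral_const_mul]
      simp only [covariantSymbol, Matrix.smul_apply, smul_eq_mul, mul_assoc, ← Finset.mul_sum])
    (fun C D D' => by
      rw [← integral_add (integrable_mul_covariantSymbol b
        (contMDiff_covariantSymbol b C).continuous D) (integrable_mul_covariantSymbol b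
        (contMDiff_covariantSymbol b C).continuous D')]
      simp only [covariantSymbol, Matrix.add_apply, add_mul, Finset.sum_add_distrib, mul_add])
    (fun c C D => by
      rw [smul_eq_mul, ← integral_const_mul]
      simp only [covariantSymbol, Matrix.smul_apply, smul_eq_mul, mul_assoc, ← Finset.mul_sum,
        mul_left_comm _ c])

variable {b}

/-- The pairing has trivial kernel, as testing C against its conjugate transpose shows, and a
finite-dimensional space has the dimension of its dual. -/
lemma symbolPairing_surjective [ConnectedSpace M] (hb : LinearIndependent ℂ b) :
    Function.Surjective (symbolPairing b) := by
  have hinj : Function.Injective (symbolPairing b) := by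
    refine (injective_iff_map_eq_zero _).2 fun C hC => ?_
    have h0 : ∫ x, covariantSymbol b C x * covariantSymbol b C.conjTranspose x ∂K.liouville = 0 :=
      LinearMap.congr_fun hC C.conjTranspose
    have hcont := (contMDiff_covariantSymbol b C).continuous
    have h1 : ∫ x, Complex.normSq (covariantSymbol b C x) ∂K.liouville = 0 := by
      simp only [covariantSymbol_conjTranspose, Complex.mul_conj, integral_complex_ofReal] at h0
      exact_mod_cast h0
    have hc : Continuous fun x => Complex.normSq (covariantSymbol b C x) :=
      Complex.continuous_normSq.comp hcont
    have h2 := (integral_eq_zero_iff_of_nonneg (fun x => Complex.normSq_nonneg _)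
      (hc.integrable_of_hasCompactSupport (HasCompactSupport.of_compactSpace _))).1 h1
    have h3 := (hc.ae_eq_iff_eq K.liouville continuous_const).1 h2
    exact eq_zero_of_sum_tensorMetric_eq_zero hb fun x => Complex.normSq_eq_zero.1 (congrFun h3 x)
  exact (LinearMap.injective_iff_surjective_of_finrank_eq_finrank
    Subspace.dual_finrank_eq.symm).1 hinj

/-- The scalar products of linearly independent holomorphic sections can be prescribed by
inserting a smooth real function, up to the Hermitian symmetry. -/
lemma exists_smooth_real_integral_eq [ConnectedSpace M] (hb : LinearIndependent ℂ b)
    {a : Matrix ι ι ℂ} (ha : a.IsHermitian) :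
    ∃ f : C^∞⟮𝓘(ℝ, CSpace n), M; 𝓘(ℝ, ℂ), ℂ⟯, (∀ x, (f x).im = 0) ∧ ∀ i j,
      ∫ x, f x * Q.metric.tensorMetric m x ((b i : SmoothSections Q m).val x)
        ((b j : SmoothSections Q m).val x) ∂K.liouville = a i j := by
  classical
  -- The functional D ↦ ∑ aᵢⱼ Dᵢⱼ is represented by C; testing it on matrix units gives the required
  -- integrals for F.
  obtain ⟨C, hC⟩ := symbolPairing_surjective hb
    (∑ i, ∑ j, a i j • Matrix.entryLinearMap ℂ ℂ i j)
  set F := covariantSymbol b C with hF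
  have hFs : ContMDiff 𝓘(ℝ, CSpace n) 𝓘(ℝ, ℂ) ∞ F := contMDiff_covariantSymbol b C
  set H : ι → ι → M → ℂ := fun i j x => Q.metric.tensorMetric m x
    ((b i : SmoothSections Q m).val x) ((b j : SmoothSections Q m).val x) with hH
  have hHc : ∀ i j, Continuous (H i j) := fun i j =>
    Q.metric.continuous_tensorMetric (b i).1.smooth (b j).1.smooth
  have hFH : ∀ i j, ∫ x, F x * H i j x ∂K.liouville = a i j := fun i j => by
    have h1 : covariantSymbol b (Matrix.single i j 1) = H i j := by
      funext x
      simp [covariantSymbol, Matrix.single_apply, hH, ite_and]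
    have h2 : ∫ x, F x * covariantSymbol b (Matrix.single i j 1) x ∂K.liouville =
        (∑ i, ∑ j, a i j • Matrix.entryLinearMap ℂ ℂ i j)
          (Matrix.single i j 1) := LinearMap.congr_fun hC (Matrix.single i j 1)
    rw [h1] at h2
    rw [h2]
    simp [LinearMap.sum_apply, Matrix.single_apply, ite_and]
  have hFH' : ∀ i j, ∫ x, conj (F x) * H i j x ∂K.liouville = a i j := fun i j => by
    have h1 := congrArg conj (hFH j i)
    rw [← integral_conj] at h1
    have h2 : conj (a j i) = a i j := ha.apply i j
    rw [← h2, ← h1]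
    refine integral_congr_ae (Filter.Eventually.of_forall fun x => ?_)
    simp only [map_mul, hH, Q.metric.conj_tensorMetric]
  -- F and its conjugate have the same integrals against every h(bᵢ, bⱼ), hence so does their mean,
  -- which is real.
  refine ⟨⟨fun x => ((F x).re : ℂ), ?_⟩, fun x => Complex.ofReal_im _, fun i j => ?_⟩
  · exact ((Complex.ofRealCLM.contDiff.comp Complex.reCLM.contDiff).contMDiff
      (n := ∞)).comp hFs
  · change ∫ x, ((F x).re : ℂ) * H i j x ∂K.liouville = a i j
    have hint : ∀ {g : M → ℂ}, Continuous g → Integrable (fun x => g x * H i j x) K.liouville :=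
      fun hg => (hg.mul (hHc i j)).integrable_of_hasCompactSupport
        (HasCompactSupport.of_compactSpace _)
    have h1 : ∀ x, ((F x).re : ℂ) * H i j x =
        (1 / 2) * (F x * H i j x + conj (F x) * H i j x) := fun x => by
      rw [Complex.re_eq_add_conj]; ring
    simp only [h1]
    rw [integral_const_mul, integral_add (hint hFs.continuous)
      (hint (g := fun x => conj (F x)) (Complex.continuous_conj.comp hFs.continuous)), hFH, hFH']
    ring

end Symbols

end Toeplitz

end

theorem proposition3p6 {n : ℕ} {M : Type*} [TopologicalSpace M] [T2Space M] [CompactSpace M]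
    [ConnectedSpace M] [ChartedSpace (CSpace n) M] [IsManifold 𝓘(ℂ, CSpace n) ω M]
    [MeasurableSpace M] [BorelSpace M] (K : KahlerForm n M)
    {L : M → Type*} [∀ x, AddCommGroup (L x)] [∀ x, Module ℂ (L x)] [∀ x, TopologicalSpace (L x)]
    [TopologicalSpace (TotalSpace ℂ L)] [FiberBundle ℂ L] [VectorBundle ℂ ℂ L]
    [ContMDiffVectorBundle ω ℂ L 𝓘(ℂ, CSpace n)] (Q : QuantumLineBundle L K) (m : ℕ)
    (A : Module.End ℂ (holomorphicSections Q m)) (hA : A.IsSymmetric) :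
    ∃ f : C^∞⟮𝓘(ℝ, CSpace n), M; 𝓘(ℝ, ℂ), ℂ⟯,
      (∀ x, (f x).im = 0) ∧ IsToeplitzOperator A f := by
  let b := Module.finBasis ℂ (holomorphicSections Q m)
  let a : Matrix (Fin _) (Fin _) ℂ := Matrix.of fun i j => inner ℂ (b i) (A (b j))
  have ha : a.IsHermitian := by
    ext i j
    change conj (inner ℂ (b j) (A (b i))) = inner ℂ (b i) (A (b j))
    rw [inner_conj_symm, hA]
  obtain ⟨f, hf, hfa⟩ := exists_smooth_real_integral_eq b.linearIndependent ha
  refine ⟨f, hf, isToeplitzOperator_of_inner_eq fun s t => ?_⟩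
  -- Multiplication by f leaves the holomorphic sections, so it is compared with A as a map into the
  -- smooth sections.
  refine inner_eq_of_basis b (S := SmoothSections.mulLinear f ∘ₗ (holomorphicSections Q m).subtype)
    (T := (holomorphicSections Q m).subtype ∘ₗ A) (fun i j => ?_) s t
  exact (SmoothSections.inner_mul f _ _).trans (hfa i j)
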